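/- **Setting.** Let the vocabulary have $N$ tokens, $\mathcal W=\{1,\dots,N\}$. For a probability vector $P$ on $\mathcal W$ let $\xi=(\pi,U)$, where $\pi$ is a uniformly random permutation of $\mathcal W$ and $U\sim U(0,1)$ is independent of $\pi$. The inverse transform watermark outputs the token $w=\pi^{-1}(F^{-1}(U;\pi))$, where $F(x;\pi)=\sum_{w'}P_{w'}\mathbf 1_{\{\pi(w')\le x\}}$ and $F^{-1}(u;\pi)=\min\{i: F(i;\pi)\ge u\}$. The pivotal statistic is $Y^{\mathrm{dif}}=|U-\eta(\pi(w))|$ with $\eta(i)=\frac{i-1}{N-1}$. Under the alternative $H_1$ its law $\mu_{1,P}$ is the one induced by the watermark with next-token distribution $P$; under the null $H_0$ the token is independent of $\xi$, so that $\pi(w)$ is uniform on $\mathcal W$ and independent of $U$, and the law of $Y^{\mathrm{dif}}$ is denoted $\mu_0$. Write $\mathbb E_{1,P}$ and $\mathbb E_0$ for the corresponding expectations. For a class $\mathcal P$ of probability vectors on $\mathcal W$ and a score function $h$, the $\mathcal P$-efficiency rate is $$R_{\mathcal P}(h)=-\inf_{\theta\ge 0}\ \sup_{P\in\mathcal P}\Bigl(\theta\,\mathbb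 E_0h(Y^{\mathrm{dif}})+\log\mathbb E_{1,P}e^{-\theta h(Y^{\mathrm{dif}})}\Bigr)\in[-\infty,\infty],$$ with $\sup\emptyset=-\infty$. Let $P_{(1)}\ge P_{(2)}\ge\cdots$ be the ordered coordinates of $P$. For $\Delta\in(0,1]$ and thresholds $(\varepsilon_N)_N$ let $\overline{\mathcal P}_\Delta=\{P: P_{(1)}\le 1-\Delta,\ P_{(2)}\le\varepsilon_N\}$, and define the limit efficiency $$\overline R_\Delta(h)=\liminf_{N\to\infty}R_{\overline{\mathcal P}_\Delta}(h).$$ **Theorem.** Fix $\Delta\in(0,1]$ and let $(\varepsilon_N)_N$ be any real sequence with $\varepsilon_N\log N\to0$. Let $$h^\star_{\mathrm{dif},\Delta}(r)=\log\frac{f_{\mathrm{dif},\Delta}(r)}{f_{\mathrm{dif},0}(r)},\qquad f_{\mathrm{dif},\Delta}(r)=\frac{2}{1-\Delta}\max\Bigl\{1-\frac r{1-\Delta},0\Bigr\},\qquad r\in[0,1],$$ with $h^\star_{\mathrm{dif},\Delta}=-\infty$ where $f_{\mathrm{dif},\Delta}$ vanishes, and let $[x]_{[-M,M]}=\max\{-M,\min\{x,M\}\}$.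 Then $$\lim_{M\to\infty}\overline R_\Delta\bigl([h^\star_{\mathrm{dif},\Delta}]_{[-M,M]}\bigr)=\infty .$$ (For $\Delta=1$ the class $\overline{\mathcal P}_\Delta$ is empty, so $\overline R_\Delta(h)=\infty$ for every $h$, whatever value is assigned to the formula for $f_{\mathrm{dif},1}$.) -/

import Mathlib

open MeasureTheory Filter Topology
open scoped ENNReal

namespace InvWatermark

noncomputable section

/-! ### The statistical framework: class-dependent efficiency -/

/-- The class-dependent efficiency rate
`R_C(h) = - inf_{θ ≥ 0} sup_{P ∈ C} (θ 𝔼₀ h(Y) + log φ_{P,h}(θ))`, `φ_{P,h}(θ) = 𝔼_{1,P} exp (-θ h(Y))`,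
of a score function `h`, for a pivotal statistic with law `μ₀` under the null hypothesis and law
`μ₁ P` under the alternative.  It is an extended real; the moment generating function is a Lebesgue
integral with values in `[0, ∞]`, and `ENNReal.log` is the logarithm with `log 0 = -∞`,
`log ∞ = ∞`. -/
def efficiency {ι : Type*} (μ₀ : Measure ℝ) (μ₁ : ι → Measure ℝ) (C : Set ι) (h : ℝ → ℝ) : EReal :=
  -(⨅ (θ : ℝ) (_ : 0 ≤ θ), ⨆ P ∈ C,
      (((θ * ∫ y, h y ∂μ₀ : ℝ) : EReal)
        + ENNReal.log (∫⁻ y, ENNReal.ofReal (Real.exp (-θ * h y)) ∂(μ₁ P))))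

/-! ### The inverse transform watermark on a vocabulary of `N` tokens

Tokens and ranks are both indexed by `Fin N`, so the rank `i : Fin N` is the rank `i + 1`
of the convention that starts at `1`. -/

/-- Permutations form a finite discrete measurable space. -/
instance permMeasurableSpace (N : ℕ) : MeasurableSpace (Equiv.Perm (Fin N)) := ⊤

/-- The law of the pseudorandom variable `ξ = (π, U)`: a uniformly random permutation `π`
(sending a token to its rank) and an independent `U ∼ U(0,1)`. -/
def seedLaw (N : ℕ) : Measure (Equiv.Perm (Fin N) × ℝ) :=
  (PMF.uniformOfFintype (Equiv.Perm (Fin N))).toMeasure.prod (volume.restrict (Set.Icc 0 1))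

/-- The permuted cumulative distribution function `F(x; π) = ∑_w P_w 1{π(w) ≤ x}`. -/
def cdf {N : ℕ} (P : Fin N → ℝ) (π : Equiv.Perm (Fin N)) (x : Fin N) : ℝ :=
  ∑ w, if π w ≤ x then P w else 0

/-- The generalized inverse `F⁻¹(u; π) = min {i : F(i; π) ≥ u}`. -/
def quantile {N : ℕ} [NeZero N] (P : Fin N → ℝ) (π : Equiv.Perm (Fin N)) (u : ℝ) : Fin N :=
  sInf {i : Fin N | u ≤ cdf P π i}

/-- The decoder `S(P, (π, u)) = π⁻¹(F⁻¹(u; π))`. -/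
def decoder {N : ℕ} [NeZero N] (P : Fin N → ℝ) (ξ : Equiv.Perm (Fin N) × ℝ) : Fin N :=
  ξ.1.symm (quantile P ξ.1 ξ.2)

/-- The normalized rank; with ranks starting at `1` it is `η(i) = (i - 1) / (N - 1)`. -/
def eta {N : ℕ} (i : Fin N) : ℝ := (i : ℝ) / ((N : ℝ) - 1)

/-- The pivotal statistic `Y = |U - η(π(w))|`. -/
def pivot {N : ℕ} (w : Fin N) (ξ : Equiv.Perm (Fin N) × ℝ) : ℝ := |ξ.2 - eta (ξ.1 w)|

/-- The law `μ_{1,P}` of `Y` under the alternative: the token is `w = S(P, ξ)`. -/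
def altLaw {N : ℕ} [NeZero N] (P : Fin N → ℝ) : Measure ℝ :=
  (seedLaw N).map fun ξ => pivot (decoder P ξ) ξ

/-- The law `μ₀` of `Y` under the null hypothesis: the rank `π(w)` is uniform on the vocabulary and
independent of `U`.  By `nullLaw_pivotal` below this is the law of `Y` for a human-written token,
that is a token of arbitrary distribution independent of `ξ`. -/
def nullLaw (N : ℕ) [NeZero N] : Measure ℝ :=
  ((PMF.uniformOfFintype (Fin N)).toMeasure.prod (volume.restrict (Set.Icc (0 : ℝ) 1))).map
    fun p => |p.2 - eta p.1|

/-- The `(k+1)`-th largest coordinate of `P`, counted with multiplicity: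
`P_{(1)} = nthLargest P 0` and `P_{(2)} = nthLargest P 1`. -/
def nthLargest {N : ℕ} (P : Fin N → ℝ) (k : ℕ) : ℝ :=
  if hk : k < N then P (Tuple.sort (fun w => -P w) ⟨k, hk⟩) else 0

/-- The belief class: next-token distributions `P` on `N` tokens with
`P_{(1)} ≤ 1 - Δ` and `P_{(2)} ≤ ε`. -/
def beliefClass (N : ℕ) (Δ ε : ℝ) : Set (Fin N → ℝ) :=
  {P | P ∈ stdSimplex ℝ (Fin N) ∧ nthLargest P 0 ≤ 1 - Δ ∧ nthLargest P 1 ≤ ε}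

/-- The limit efficiency `liminf R(h)` over the belief classes with thresholds `ε N`, as the
vocabulary size `N = n + 1` tends to infinity. -/
def limitEfficiency (ε : ℕ → ℝ) (Δ : ℝ) (h : ℝ → ℝ) : EReal :=
  liminf (fun n : ℕ =>
    efficiency (nullLaw (n + 1)) altLaw (beliefClass (n + 1) Δ (ε (n + 1))) h) atTop

/-! ### The score function -/

/-- `f_{dif,Δ}(r) = 2 / (1 - Δ) * max (1 - r / (1 - Δ)) 0`. -/
def fdif (Δ r : ℝ) : ℝ := 2 / (1 - Δ) * max (1 - r / (1 - Δ)) 0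

/-- The log-likelihood ratio `h⋆_{dif,Δ} = log (f_{dif,Δ} / f_{dif,0})`, equal to `-∞` where
`f_{dif,Δ}` vanishes. -/
def hdif (Δ r : ℝ) : EReal := ENNReal.log (ENNReal.ofReal (fdif Δ r / fdif 0 r))

/-- The truncation `[h]_{[-M,M]}` of an extended-real-valued function. -/
def truncate (M : ℝ) (h : ℝ → EReal) (r : ℝ) : ℝ :=
  (max ((-M : ℝ) : EReal) (min (h r) (M : EReal))).toReal

/-! ### The laws above are well defined -/

instance permDiscrete (N : ℕ) : DiscreteMeasurableSpace (Equiv.Perm (Fin N)) :=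
  ⟨fun _ => trivial⟩

instance unifProb : IsProbabilityMeasure (volume.restrict (Set.Icc (0 : ℝ) 1)) :=
  ⟨by simp⟩

instance seedProb (N : ℕ) : IsProbabilityMeasure (seedLaw N) := by
  unfold seedLaw; infer_instance

theorem measurable_quantile {N : ℕ} [NeZero N] (P : Fin N → ℝ) (π : Equiv.Perm (Fin N)) :
    Measurable (quantile P π) := by
  have : quantile P π =
      (fun s : Fin N → Prop => sInf {i | s i}) ∘ fun u i => u ≤ cdf P π i := rfl
  rw [this]
  refine (Measurable.of_discrete).comp (measurable_pi_iff.2 fun i => ?_)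
  exact measurableSet_setOfPred.1 measurableSet_Iic

theorem measurable_pivot_decoder {N : ℕ} [NeZero N] (P : Fin N → ℝ) :
    Measurable fun ξ : Equiv.Perm (Fin N) × ℝ => pivot (decoder P ξ) ξ := by
  refine measurable_from_prod_countable_right fun π => ?_
  have h : Measurable fun u : ℝ => eta (quantile P π u) :=
    (Measurable.of_discrete (f := eta)).comp (measurable_quantile P π)
  simpa [pivot, decoder] using (measurable_id.sub h).abs

instance altProb {N : ℕ} [NeZero N] (P : Fin N → ℝ) : IsProbabilityMeasure (altLaw P) :=
  Measure.isProbabilityMeasure_map (measurable_pivot_decoder P).aemeasurable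

theorem measurable_rank {N : ℕ} : Measurable fun p : Fin N × ℝ => |p.2 - eta p.1| := by
  refine measurable_from_prod_countable_right fun i => ?_
  exact ((measurable_id (α := ℝ)).sub (measurable_const (a := eta i))).abs

instance nullProb (N : ℕ) [NeZero N] : IsProbabilityMeasure (nullLaw N) :=
  Measure.isProbabilityMeasure_map measurable_rank.aemeasurable

theorem map_perm_apply {N : ℕ} [NeZero N] (w : Fin N) :
    (PMF.uniformOfFintype (Equiv.Perm (Fin N))).toMeasure.map (fun π => π w)
      = (PMF.uniformOfFintype (Fin N)).toMeasure := by
  classical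
  have hcard : ∀ i j : Fin N, Fintype.card {π : Equiv.Perm (Fin N) // π w = i}
      = Fintype.card {π : Equiv.Perm (Fin N) // π w = j} := fun i j =>
    Fintype.card_congr ((Equiv.mulLeft (Equiv.swap i j)).subtypeEquiv fun π => by
      simp [Equiv.swap_apply_eq_iff])
  have hsum : ∀ i : Fin N, Fintype.card (Equiv.Perm (Fin N))
      = N * Fintype.card {π : Equiv.Perm (Fin N) // π w = i} := fun i => by
    rw [Fintype.card_congr (Equiv.sigmaFiberEquiv fun π : Equiv.Perm (Fin N) => π w).symm,
      Fintype.card_sigma, Finset.sum_congr rfl fun j _ => hcard j i]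
    simp
  refine Measure.ext_of_singleton fun i => ?_
  rw [Measure.map_apply Measurable.of_discrete (measurableSet_singleton i),
    PMF.toMeasure_uniformOfFintype_apply _ (MeasurableSet.of_discrete),
    PMF.toMeasure_uniformOfFintype_apply _ (MeasurableSet.of_discrete)]
  have hN : (N : ℝ≥0∞) ≠ 0 := by simp [NeZero.ne N]
  have h1 := hsum i
  have h2 : Fintype.card {π : Equiv.Perm (Fin N) // π w = i} ≠ 0 := fun h0 => by
    rw [h0, mul_zero] at h1; exact Fintype.card_ne_zero h1
  have h3 : Fintype.card ((fun π : Equiv.Perm (Fin N) => π w) ⁻¹' {i})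
      = Fintype.card {π : Equiv.Perm (Fin N) // π w = i} := Fintype.card_congr (Equiv.refl _)
  rw [h3, h1]
  push_cast
  rw [ENNReal.div_eq_div_iff]
  all_goals first
    | exact ENNReal.mul_ne_top (ENNReal.natCast_ne_top _) (ENNReal.natCast_ne_top _)
    | simp_all [mul_comm]

/-- Pivotality: `nullLaw N` is the law of `Y` for a token of arbitrary distribution `Q`
independent of `ξ`. -/
theorem nullLaw_pivotal {N : ℕ} [NeZero N] (Q : Measure (Fin N)) [IsProbabilityMeasure Q] :
    (Q.prod (seedLaw N)).map (fun p => pivot p.1 p.2) = nullLaw N := by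
  have hw : ∀ w : Fin N, Measurable fun ξ : Equiv.Perm (Fin N) × ℝ => pivot w ξ := fun w =>
    measurable_rank.comp ((Measurable.of_discrete (f := fun π : Equiv.Perm (Fin N) => π w)).prodMap
      (measurable_id (α := ℝ)))
  have hmap : ∀ w : Fin N, (seedLaw N).map (pivot w) = nullLaw N := fun w => by
    have h := Measure.map_prod_map (PMF.uniformOfFintype (Equiv.Perm (Fin N))).toMeasure
      (volume.restrict (Set.Icc (0 : ℝ) 1))
      (Measurable.of_discrete (f := fun π : Equiv.Perm (Fin N) => π w)) (measurable_id (α := ℝ))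
    rw [map_perm_apply, Measure.map_id] at h
    rw [nullLaw, h, Measure.map_map measurable_rank (Measurable.of_discrete.prodMap measurable_id)]
    rfl
  have hm : Measurable fun p : Fin N × (Equiv.Perm (Fin N) × ℝ) => pivot p.1 p.2 :=
    measurable_from_prod_countable_right hw
  refine Measure.ext fun s hs => ?_
  rw [Measure.map_apply hm hs, Measure.prod_apply (hm hs)]
  have : ∀ w : Fin N, seedLaw N (Prod.mk w ⁻¹' ((fun p => pivot p.1 p.2) ⁻¹' s))
      = nullLaw N s := fun w => by
    rw [← hmap w, Measure.map_apply (hw w) hs]; rfl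
  simp [this]

end

end InvWatermark

namespace InvWatermark

/-! ### Second moments of linear statistics of a uniform permutation -/

/-! Put `c = 1 - Δ`. The score equals `-M` on `[c, ∞)`, a set that the null law charges with mass at
least `Δ² / 8` (`le_nullLaw_tail`), so the null mean of the score is at most `L - M Δ² / 8` with `L`
free of `M`.

Under the alternative, `Y` stays below `c` by a margin with high probability
(`exists_altLaw_tail_le`). Apart from the top token, all masses are at most `ε → 0`, so by Chebyshev
their permuted distribution function is nearly linear. The top token adds a single jump of height at
most `c`; it can move the quantile by almost `c` only if its rank is extreme, which is rare. Hence
for every `ρ` some `t < c` has `Y > t` with probability at most `ρ`, uniformly over the class and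
all large `N`, and on `r ≤ t` the score is at least `-C` with `C` free of `M`.

Taking `θ = a / M` and `ρ = exp (-a)` bounds the Laplace transform by `exp (a C / M) + exp a * ρ ≤ e
+ 1` once `M ≥ a C`, while `θ` times the null mean is at most `a L / M - a Δ² / 8`. The rate is thus
at least `a Δ² / 8` up to a constant, and `a` is arbitrary. -/

/-- Sampling without replacement is negatively correlated: the covariances of `f (π w)` with all `f
(π v)`, `v ≠ w`, agree by symmetry and, with the nonnegative variance, add up to zero. -/
theorem sum_perm_mul_nonpos {α : Type*} [Fintype α] [DecidableEq α] {f : α → ℝ}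
    (hf : ∑ x, f x = 0) {w w' : α} (hw : w' ≠ w) :
    ∑ π : Equiv.Perm α, f (π w) * f (π w') ≤ 0 := by
  have hsymm : ∀ v ∈ Finset.univ.erase w, ∑ π : Equiv.Perm α, f (π w) * f (π v)
      = ∑ π : Equiv.Perm α, f (π w) * f (π w') := fun v hv => by
    have hv' : v ≠ w := Finset.ne_of_mem_erase hv
    -- Precomposing `π` with the swap of `w'` and `v` keeps `π w` and exchanges the other two
    -- values.
    rw [← Equiv.sum_comp (Equiv.mulRight (Equiv.swap w' v))]
    refine Finset.sum_congr rfl fun π _ => ?_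
    simp [Equiv.swap_apply_of_ne_of_ne hw.symm hv'.symm]
  have htotal : ∑ v, ∑ π : Equiv.Perm α, f (π w) * f (π v) = 0 := by
    rw [Finset.sum_comm]
    refine Finset.sum_eq_zero fun π _ => ?_
    rw [← Finset.mul_sum, Equiv.sum_comp π f, hf, mul_zero]
  rw [← Finset.sum_erase_add _ _ (Finset.mem_univ w), Finset.sum_congr rfl hsymm,
    Finset.sum_const, nsmul_eq_mul] at htotal
  have hsq : 0 ≤ ∑ π : Equiv.Perm α, f (π w) * f (π w) :=
    Finset.sum_nonneg fun π _ => mul_self_nonneg _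
  have hcard : (0 : ℝ) < (Finset.univ.erase w).card :=
    Nat.cast_pos.2 (Finset.card_pos.2 ⟨w', by simp [hw]⟩)
  by_contra! h
  linarith [mul_pos hcard h]

/-- On expanding the square, the cross terms are nonpositive and can be dropped. -/
theorem sum_perm_sq_le {α : Type*} [Fintype α] [DecidableEq α] {f Q : α → ℝ}
    (hf : ∑ x, f x = 0) (hf1 : ∀ x, |f x| ≤ 1) (hQ : ∀ x, 0 ≤ Q x) :
    ∑ π : Equiv.Perm α, (∑ w, Q w * f (π w)) ^ 2
      ≤ Fintype.card (Equiv.Perm α) * ∑ w, Q w ^ 2 := by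
  have hexp : ∑ π : Equiv.Perm α, (∑ w, Q w * f (π w)) ^ 2
      = ∑ w, ∑ w', Q w * Q w' * ∑ π : Equiv.Perm α, f (π w) * f (π w') := by
    simp_rw [sq, Finset.sum_mul_sum, Finset.mul_sum]
    rw [Finset.sum_comm]
    refine Finset.sum_congr rfl fun w _ => ?_
    rw [Finset.sum_comm]
    exact Finset.sum_congr rfl fun w' _ => Finset.sum_congr rfl fun π _ => by ring
  rw [hexp, Finset.mul_sum]
  refine Finset.sum_le_sum fun w _ => ?_
  rw [← Finset.sum_erase_add _ _ (Finset.mem_univ w)]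
  have hoff : ∑ w' ∈ Finset.univ.erase w,
      Q w * Q w' * ∑ π : Equiv.Perm α, f (π w) * f (π w') ≤ 0 :=
    Finset.sum_nonpos fun w' hw' => mul_nonpos_of_nonneg_of_nonpos
      (mul_nonneg (hQ w) (hQ w')) (sum_perm_mul_nonpos hf (Finset.ne_of_mem_erase hw'))
  have hdiag : ∑ π : Equiv.Perm α, f (π w) * f (π w) ≤ Fintype.card (Equiv.Perm α) := by
    refine (Finset.sum_le_card_nsmul _ _ 1 fun π _ => ?_).trans_eq (by simp)
    rw [← abs_mul_abs_self]
    exact mul_le_one₀ (hf1 _) (abs_nonneg _) (hf1 _)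
  nlinarith [mul_le_mul_of_nonneg_left hdiag (mul_self_nonneg (Q w))]

/-- Chebyshev's inequality for the mass that a uniform permutation moves into a set `A` of ranks. -/
theorem uniformPerm_deviation_le {N : ℕ} [NeZero N] {Q : Fin N → ℝ} (hQ : ∀ w, 0 ≤ Q w)
    (A : Finset (Fin N)) {δ : ℝ} (hδ : 0 < δ) :
    (PMF.uniformOfFintype (Equiv.Perm (Fin N))).toMeasure
      {π | δ ≤ |∑ w, Q w * ((if π w ∈ A then 1 else 0) - (A.card : ℝ) / N)|}
      ≤ ENNReal.ofReal ((∑ w, Q w ^ 2) / δ ^ 2) := by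
  classical
  have hN : (0 : ℝ) < N := Nat.cast_pos.2 (NeZero.pos N)
  set f : Fin N → ℝ := fun x => (if x ∈ A then 1 else 0) - (A.card : ℝ) / N with hfdef
  have hf : ∑ x, f x = 0 := by
    simp only [hfdef, Finset.sum_sub_distrib, Finset.sum_const, Finset.card_univ,
      Fintype.card_fin, nsmul_eq_mul]
    simp only [Finset.sum_boole, Finset.filter_mem_eq_inter, Finset.univ_inter]
    field_simp
    simp
  have hf1 : ∀ x, |f x| ≤ 1 := fun x => by
    have h0 : 0 ≤ (A.card : ℝ) / N := by positivity
    have h1 : (A.card : ℝ) / N ≤ 1 := by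
      rw [div_le_one hN]
      exact_mod_cast (Finset.card_le_univ A).trans_eq (Fintype.card_fin N)
    simp only [hfdef]
    split_ifs <;> rw [abs_le] <;> constructor <;> linarith
  have key := sum_perm_sq_le hf hf1 hQ
  set S : Finset (Equiv.Perm (Fin N)) :=
    Finset.univ.filter fun π => δ ≤ |∑ w, Q w * f (π w)| with hS
  have hSle : (S.card : ℝ) * δ ^ 2 ≤ Fintype.card (Equiv.Perm (Fin N)) * ∑ w, Q w ^ 2 := by
    refine le_trans ?_ key
    rw [← nsmul_eq_mul]
    refine (Finset.card_nsmul_le_sum S (fun π => (∑ w, Q w * f (π w)) ^ 2) _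
      fun π hπ => ?_).trans (Finset.sum_le_univ_sum_of_nonneg fun π => sq_nonneg _)
    have := (Finset.mem_filter.1 hπ).2
    rw [← sq_abs (∑ w, _)]
    gcongr
  have hset : {π : Equiv.Perm (Fin N) |
      δ ≤ |∑ w, Q w * ((if π w ∈ A then 1 else 0) - (A.card : ℝ) / N)|} = (S : Set _) := by
    ext π; simp [hS, hfdef]
  rw [hset, PMF.toMeasure_uniformOfFintype_apply _ MeasurableSet.of_discrete]
  have hC : (0 : ℝ) < Fintype.card (Equiv.Perm (Fin N)) := Nat.cast_pos.2 Fintype.card_pos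
  refine ENNReal.div_le_of_le_mul ?_
  rw [← ENNReal.ofReal_natCast, ← ENNReal.ofReal_natCast, ← ENNReal.ofReal_mul (by positivity)]
  refine ENNReal.ofReal_le_ofReal ?_
  rw [div_mul_eq_mul_div, le_div_iff₀ (by positivity)]
  simpa [mul_comm] using hSle

/-- The rank of a fixed token is rarely extreme. -/
theorem uniformPerm_extreme_rank_le {N : ℕ} [NeZero N] (hN : 2 ≤ N) (w : Fin N) {β : ℝ}
    (hβ : 0 ≤ β) :
    (PMF.uniformOfFintype (Equiv.Perm (Fin N))).toMeasure
      {π | eta (π w) < β ∨ 1 - β < eta (π w)} ≤ ENNReal.ofReal (2 * β + 2 / N) := by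
  classical
  have hN' : (2 : ℝ) ≤ N := by exact_mod_cast hN
  have hset : {π : Equiv.Perm (Fin N) | eta (π w) < β ∨ 1 - β < eta (π w)}
      = (fun π : Equiv.Perm (Fin N) => π w) ⁻¹' {i | eta i < β ∨ 1 - β < eta i} := rfl
  rw [hset, ← Measure.map_apply Measurable.of_discrete MeasurableSet.of_discrete, map_perm_apply,
    PMF.toMeasure_uniformOfFintype_apply _ MeasurableSet.of_discrete, Fintype.card_fin]
  set k := ⌈β * (N - 1)⌉₊ with hk
  have hkle : (k : ℝ) ≤ β * (N - 1) + 1 :=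
    (Nat.ceil_lt_add_one (mul_nonneg hβ (by linarith))).le
  have hcard : Fintype.card ({i : Fin N | eta i < β ∨ 1 - β < eta i} : Set (Fin N)) ≤ k + k := by
    rw [← Set.toFinset_card]
    have hsub : ({i : Fin N | eta i < β ∨ 1 - β < eta i} : Set (Fin N)).toFinset.image Fin.val
        ⊆ Finset.range k ∪ Finset.Ico (N - k) N := by
      intro m hm
      simp only [Finset.mem_image, Set.mem_toFinset, Set.mem_ofPred_eq] at hm
      obtain ⟨i, hi, rfl⟩ := hm
      have hi1 : (i : ℝ) + 1 ≤ N := by exact_mod_cast i.2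
      rw [eta, div_lt_iff₀ (by linarith), lt_div_iff₀ (by linarith)] at hi
      rw [Finset.mem_union, Finset.mem_range, Finset.mem_Ico]
      refine hi.imp (fun h => Nat.lt_ceil.2 h) fun h => ⟨?_, i.2⟩
      -- The upper ranks are counted through the reflection `i ↦ N - 1 - i`.
      have h2 : N - 1 - (i : ℕ) < k := by
        refine Nat.lt_ceil.2 ?_
        rw [Nat.cast_sub (by omega), Nat.cast_sub (by omega)]
        push_cast
        linarith
      omega
    rw [← Finset.card_image_of_injective _ Fin.val_injective]
    refine (Finset.card_le_card hsub).trans ((Finset.card_union_le _ _).trans ?_)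
    simp only [Finset.card_range, Nat.card_Ico]
    omega
  refine ENNReal.div_le_of_le_mul ?_
  rw [← ENNReal.ofReal_natCast, ← ENNReal.ofReal_natCast, ← ENNReal.ofReal_mul (by positivity)]
  refine ENNReal.ofReal_le_ofReal ?_
  have hcard' : (Fintype.card ({i : Fin N | eta i < β ∨ 1 - β < eta i} : Set (Fin N)) : ℝ)
      ≤ k + k := by exact_mod_cast hcard
  have : (2 * β + 2 / N) * N = 2 * β * N + 2 := by field_simp
  rw [this]
  nlinarith

/-! ### The quantile -/

/-- The last rank has distribution function `1 ≥ u`, so the infimum is over a nonempty finite set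
and is attained. -/
theorem le_cdf_quantile {N : ℕ} [NeZero N] {P : Fin N → ℝ} (hP : ∑ w, P w = 1)
    (π : Equiv.Perm (Fin N)) {u : ℝ} (hu : u ≤ 1) : u ≤ cdf P π (quantile P π u) := by
  have hne : {i : Fin N | u ≤ cdf P π i}.Nonempty := by
    refine ⟨⊤, ?_⟩
    simpa [cdf, hP] using hu
  exact hne.csInf_mem (Set.toFinite _)

/-- A set of ranks that contains the ranks up to the quantile carries mass at least `u`. -/
theorem le_sum_of_quantile_mem {N : ℕ} [NeZero N] {P : Fin N → ℝ} (hP : P ∈ stdSimplex ℝ (Fin N))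
    (π : Equiv.Perm (Fin N)) {u : ℝ} (hu : u ≤ 1) {A : Finset (Fin N)}
    (hA : ∀ i ≤ quantile P π u, i ∈ A) : u ≤ ∑ w, P w * (if π w ∈ A then 1 else 0) := by
  refine (le_cdf_quantile hP.2 π hu).trans (Finset.sum_le_sum fun w _ => ?_)
  have h0 := hP.1 w
  by_cases h : π w ≤ quantile P π u
  · simp [h, hA _ h]
  · simp only [h, if_false]
    split_ifs <;> simp [h0]

/-- A set of ranks below the quantile carries mass at most `u`. -/
theorem sum_le_of_lt_quantile {N : ℕ} [NeZero N] {P : Fin N → ℝ} (hP : P ∈ stdSimplex ℝ (Fin N))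
    (π : Equiv.Perm (Fin N)) {u : ℝ} (hu : 0 ≤ u) {A : Finset (Fin N)}
    (hA : ∀ i ∈ A, i < quantile P π u) : ∑ w, P w * (if π w ∈ A then 1 else 0) ≤ u := by
  rcases A.eq_empty_or_nonempty with rfl | hne
  · simpa using hu
  have hm : ¬ u ≤ cdf P π (A.max' hne) := fun h =>
    (hA _ (A.max'_mem hne)).not_ge (csInf_le (Set.toFinite _).bddBelow h)
  refine le_trans (Finset.sum_le_sum fun w _ => ?_) (not_le.1 hm).le
  have h0 := hP.1 w
  by_cases h : π w ∈ A
  · simp [h, A.le_max' _ h]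
  · simp only [h, if_false, mul_zero]
    split_ifs <;> simp [h0]

/-! ### Ordered coordinates -/

/-- The token of largest probability. -/
noncomputable def topToken {N : ℕ} [NeZero N] (P : Fin N → ℝ) : Fin N :=
  Tuple.sort (fun w => -P w) ⟨0, NeZero.pos N⟩

theorem apply_topToken {N : ℕ} [NeZero N] (P : Fin N → ℝ) :
    P (topToken P) = nthLargest P 0 := by
  rw [nthLargest, dif_pos (NeZero.pos N), topToken]

theorem le_nthLargest_zero {N : ℕ} [NeZero N] (P : Fin N → ℝ) (w : Fin N) :
    P w ≤ nthLargest P 0 := by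
  have h := Tuple.monotone_sort (fun w => -P w)
    (show (⟨0, NeZero.pos N⟩ : Fin N) ≤ (Tuple.sort fun w => -P w).symm w from
      Fin.mk_le_of_le_val (Nat.zero_le _))
  rw [← apply_topToken, topToken]
  simpa using h

theorem le_nthLargest_one {N : ℕ} [NeZero N] (P : Fin N → ℝ) {w : Fin N} (hw : w ≠ topToken P) :
    P w ≤ nthLargest P 1 := by
  have hpos : 0 < ((Tuple.sort fun w => -P w).symm w : ℕ) := by
    refine Nat.pos_of_ne_zero fun h => hw ?_
    rw [topToken, ← Equiv.symm_apply_eq]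
    exact Fin.ext h
  have h1 : 1 < N := lt_of_le_of_lt hpos ((Tuple.sort fun w => -P w).symm w).2
  have h := Tuple.monotone_sort (fun w => -P w)
    (show (⟨1, h1⟩ : Fin N) ≤ (Tuple.sort fun w => -P w).symm w from Fin.mk_le_of_le_val hpos)
  rw [nthLargest, dif_pos h1]
  simpa using h

/-! ### The tail of the pivotal statistic under the alternative -/

theorem card_eta_lt_le {N : ℕ} (hN : 2 ≤ N) {s : ℝ} (hs : 0 ≤ s) :
    ((Finset.univ.filter fun i : Fin N => eta i < s).card : ℝ) / N ≤ s + 1 / N := by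
  have hN' : (2 : ℝ) ≤ N := by exact_mod_cast hN
  have hsub : (Finset.univ.filter fun i : Fin N => eta i < s).image Fin.val
      ⊆ Finset.range ⌈s * (N - 1)⌉₊ := by
    intro m hm
    simp only [Finset.mem_image, Finset.mem_filter, Finset.mem_univ, true_and] at hm
    obtain ⟨i, hi, rfl⟩ := hm
    rw [eta, div_lt_iff₀ (by linarith)] at hi
    exact Finset.mem_range.2 (Nat.lt_ceil.2 hi)
  have hcard := Finset.card_le_card hsub
  rw [Finset.card_image_of_injective _ Fin.val_injective, Finset.card_range] at hcard
  have hceil := (Nat.ceil_lt_add_one (mul_nonneg hs (by linarith : (0 : ℝ) ≤ N - 1))).le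
  have hcard' : ((Finset.univ.filter fun i : Fin N => eta i < s).card : ℝ)
      ≤ ⌈s * ((N : ℝ) - 1)⌉₊ := by exact_mod_cast hcard
  rw [div_le_iff₀ (by linarith), add_mul, one_div, inv_mul_cancel₀ (by linarith)]
  nlinarith

theorem le_card_eta_le {N : ℕ} (hN : 2 ≤ N) {s : ℝ} (hs : 0 ≤ s) (hs1 : s < 1) :
    s - 1 / N ≤ ((Finset.univ.filter fun i : Fin N => eta i ≤ s).card : ℝ) / N := by
  have hN' : (2 : ℝ) ≤ N := by exact_mod_cast hN
  have hnn : 0 ≤ s * ((N : ℝ) - 1) := mul_nonneg hs (by linarith)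
  have hsub : Finset.range (⌊s * ((N : ℝ) - 1)⌋₊ + 1)
      ⊆ (Finset.univ.filter fun i : Fin N => eta i ≤ s).image Fin.val := by
    intro m hm
    have hm' : (m : ℝ) ≤ s * (N - 1) :=
      (Nat.le_floor_iff hnn).1 (Nat.lt_succ_iff.1 (Finset.mem_range.1 hm))
    have hmN : m < N := by
      have : (m : ℝ) < N := by nlinarith
      exact_mod_cast this
    simp only [Finset.mem_image, Finset.mem_filter, Finset.mem_univ, true_and]
    exact ⟨⟨m, hmN⟩, by rw [eta, div_le_iff₀ (by linarith)]; exact hm', rfl⟩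
  have hcard := Finset.card_le_card hsub
  rw [Finset.card_image_of_injective _ Fin.val_injective, Finset.card_range] at hcard
  have hfloor := Nat.lt_floor_add_one (s * ((N : ℝ) - 1))
  have hcard' : ((⌊s * ((N : ℝ) - 1)⌋₊ + 1 : ℕ) : ℝ)
      ≤ (Finset.univ.filter fun i : Fin N => eta i ≤ s).card := by exact_mod_cast hcard
  push_cast at hcard'
  rw [le_div_iff₀ (by linarith), sub_mul, one_div, inv_mul_cancel₀ (by linarith)]
  nlinarith

theorem eta_le_one {N : ℕ} (hN : 2 ≤ N) (i : Fin N) : eta i ≤ 1 := by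
  have hN' : (2 : ℝ) ≤ N := by exact_mod_cast hN
  have hi1 : (i : ℝ) + 1 ≤ N := by exact_mod_cast i.2
  rw [eta, div_le_one (by linarith)]
  linarith

theorem eta_nonneg {N : ℕ} (hN : 2 ≤ N) (i : Fin N) : 0 ≤ eta i := by
  have hN' : (2 : ℝ) ≤ N := by exact_mod_cast hN
  exact div_nonneg (Nat.cast_nonneg _) (by linarith)

/-- The distribution `P` with the mass of the token `w₀` removed. -/
noncomputable def removeToken {N : ℕ} (P : Fin N → ℝ) (w₀ : Fin N) (w : Fin N) : ℝ :=
  if w = w₀ then 0 else P w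

theorem sum_mul_eq_removeToken {N : ℕ} (P : Fin N → ℝ) (w₀ : Fin N) (a : Fin N → ℝ) :
    ∑ w, P w * a w = P w₀ * a w₀ + ∑ w, removeToken P w₀ w * a w := by
  rw [← Finset.add_sum_erase _ _ (Finset.mem_univ w₀),
    ← Finset.add_sum_erase _ (fun w => removeToken P w₀ w * a w) (Finset.mem_univ w₀)]
  simp only [removeToken, if_true, zero_mul, zero_add]
  congr 1
  refine Finset.sum_congr rfl fun w hw => ?_
  rw [if_neg (Finset.ne_of_mem_erase hw)]

theorem sum_removeToken {N : ℕ} {P : Fin N → ℝ} (hP : ∑ w, P w = 1) (w₀ : Fin N) :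
    ∑ w, removeToken P w₀ w = 1 - P w₀ := by
  have h := sum_mul_eq_removeToken P w₀ fun _ => 1
  simp only [mul_one] at h
  linarith

theorem sum_removeToken_centered {N : ℕ} {P : Fin N → ℝ} (hP : ∑ w, P w = 1) (w₀ : Fin N)
    (a : Fin N → ℝ) (q : ℝ) :
    ∑ w, removeToken P w₀ w * (a w - q)
      = ∑ w, P w * a w - P w₀ * a w₀ - (1 - P w₀) * q := by
  simp_rw [mul_sub, Finset.sum_sub_distrib, ← Finset.sum_mul]
  rw [sum_removeToken hP, sum_mul_eq_removeToken P w₀ a]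
  ring

theorem sum_removeToken_sq_le {N : ℕ} {P : Fin N → ℝ} (hP : P ∈ stdSimplex ℝ (Fin N))
    {w₀ : Fin N} {e : ℝ} (he : 0 ≤ e) (hPe : ∀ w ≠ w₀, P w ≤ e) :
    ∑ w, removeToken P w₀ w ^ 2 ≤ e := by
  calc ∑ w, removeToken P w₀ w ^ 2 ≤ ∑ w, e * P w := by
        refine Finset.sum_le_sum fun w _ => ?_
        have h0 := hP.1 w
        by_cases h : w = w₀
        · simpa [removeToken, h] using mul_nonneg he (hP.1 w₀)
        · simp only [removeToken, h, if_false, sq]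
          exact mul_le_mul_of_nonneg_right (hPe w h) h0
    _ = e := by rw [← Finset.mul_sum, hP.2, mul_one]

/-- With `s = u - t` and `p = P w₀`, the ranks with `eta < s` carry mass at least `s + t`, of which
the other tokens are expected to supply only about `(1 - p) s`. If `w₀` lies among these ranks, the
excess is at least `t - p (1 - s)` up to `1 / N`, and `β ≤ eta (π w₀) < s`; otherwise it is at least
`t + p s` up to `1 / N`. -/
theorem deviation_of_quantile_lt {N : ℕ} [NeZero N] (hN : 2 ≤ N) {P : Fin N → ℝ}
    (hP : P ∈ stdSimplex ℝ (Fin N)) {w₀ : Fin N} {c β t u : ℝ} (hc : P w₀ ≤ c) (hβ : β ≤ 1)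
    (hu1 : u ≤ 1) {π : Equiv.Perm (Fin N)} (hπ : β ≤ eta (π w₀))
    (hq : eta (quantile P π u) < u - t) :
    t - c * (1 - β) - 1 / N ≤ ∑ w, removeToken P w₀ w *
      ((if π w ∈ Finset.univ.filter fun i : Fin N => eta i < u - t then 1 else 0)
        - ((Finset.univ.filter fun i : Fin N => eta i < u - t).card : ℝ) / N) := by
  have hN' : (2 : ℝ) ≤ N := by exact_mod_cast hN
  rw [sum_removeToken_centered hP.2 w₀
    (fun w => if π w ∈ Finset.univ.filter fun i : Fin N => eta i < u - t then 1 else 0)]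
  have hs : 0 ≤ u - t := (eta_nonneg hN _).trans hq.le
  have hsum : u ≤ ∑ w, P w *
      (if π w ∈ Finset.univ.filter fun i : Fin N => eta i < u - t then 1 else 0) := by
    refine le_sum_of_quantile_mem hP π hu1 fun i hi => ?_
    rw [Finset.mem_filter]
    refine ⟨Finset.mem_univ _, lt_of_le_of_lt ?_ hq⟩
    have : (i : ℝ) ≤ (quantile P π u : Fin N) := by exact_mod_cast hi
    exact div_le_div_of_nonneg_right this (by linarith)
  have hcard := card_eta_lt_le hN hs
  have hp0 : 0 ≤ P w₀ := hP.1 w₀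
  have hp1 : P w₀ ≤ 1 := by
    rw [← hP.2]; exact Finset.single_le_sum (fun w _ => hP.1 w) (Finset.mem_univ _)
  have hNinv : 0 ≤ 1 / (N : ℝ) := by positivity
  have h1 := mul_le_mul_of_nonneg_left hcard (sub_nonneg.2 hp1)
  have h2 := mul_le_mul_of_nonneg_right hc (sub_nonneg.2 hβ)
  have h3 := mul_nonneg hp0 hNinv
  simp only [Finset.mem_filter, Finset.mem_univ, true_and] at hsum ⊢
  by_cases hV : eta (π w₀) < u - t
  · simp only [hV, if_true]
    nlinarith [mul_le_mul_of_nonneg_left (hπ.trans hV.le) hp0]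
  · simp only [hV, if_false]
    nlinarith [mul_nonneg hp0 hs, mul_nonneg (hp0.trans hc) (sub_nonneg.2 hβ)]

/-- Mirror image with `s = u + t`: the ranks with `eta ≤ s` carry mass at most `s - t`. The bad case
is now `w₀` above `s`, with deficit about `t - p s`, where `s < eta (π w₀) ≤ 1 - β`. -/
theorem deviation_of_lt_quantile {N : ℕ} [NeZero N] (hN : 2 ≤ N) {P : Fin N → ℝ}
    (hP : P ∈ stdSimplex ℝ (Fin N)) {w₀ : Fin N} {c β t u : ℝ} (hc : P w₀ ≤ c) (hβ : β ≤ 1)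
    (ht : 0 ≤ t) (hu0 : 0 ≤ u) {π : Equiv.Perm (Fin N)} (hπ : eta (π w₀) ≤ 1 - β)
    (hq : u + t < eta (quantile P π u)) :
    t - c * (1 - β) - 1 / N ≤ -∑ w, removeToken P w₀ w *
      ((if π w ∈ Finset.univ.filter fun i : Fin N => eta i ≤ u + t then 1 else 0)
        - ((Finset.univ.filter fun i : Fin N => eta i ≤ u + t).card : ℝ) / N) := by
  have hN' : (2 : ℝ) ≤ N := by exact_mod_cast hN
  rw [sum_removeToken_centered hP.2 w₀
    (fun w => if π w ∈ Finset.univ.filter fun i : Fin N => eta i ≤ u + t then 1 else 0)]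
  have hs : 0 ≤ u + t := add_nonneg hu0 ht
  have hs1 : u + t < 1 := hq.trans_le (eta_le_one hN _)
  have hsum : ∑ w, P w *
      (if π w ∈ Finset.univ.filter fun i : Fin N => eta i ≤ u + t then 1 else 0) ≤ u := by
    refine sum_le_of_lt_quantile hP π hu0 fun i hi => ?_
    by_contra! h
    have : ((quantile P π u : Fin N) : ℝ) ≤ i := by exact_mod_cast h
    have h' : eta (quantile P π u) ≤ eta i := div_le_div_of_nonneg_right this (by linarith)
    linarith [(Finset.mem_filter.1 hi).2]
  have hcard := le_card_eta_le hN hs hs1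
  have hp0 : 0 ≤ P w₀ := hP.1 w₀
  have hp1 : P w₀ ≤ 1 := by
    rw [← hP.2]; exact Finset.single_le_sum (fun w _ => hP.1 w) (Finset.mem_univ _)
  have hNinv : 0 ≤ 1 / (N : ℝ) := by positivity
  have h1 := mul_le_mul_of_nonneg_left hcard (sub_nonneg.2 hp1)
  have h2 := mul_le_mul_of_nonneg_right hc (sub_nonneg.2 hβ)
  have h3 := mul_nonneg hp0 hNinv
  simp only [Finset.mem_filter, Finset.mem_univ, true_and] at hsum ⊢
  by_cases hV : eta (π w₀) ≤ u + t
  · simp only [hV, if_true]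
    nlinarith [mul_nonneg hp0 (sub_nonneg.2 hs1.le), mul_nonneg (hp0.trans hc) (sub_nonneg.2 hβ)]
  · simp only [hV, if_false]
    nlinarith [mul_le_mul_of_nonneg_left ((not_le.1 hV).le.trans hπ) hp0]

/-- For fixed `u` the rank sets `A` and `B` do not depend on `π`, so Chebyshev applies to each. A
large `Y` forces an extreme rank of `w₀` or a deviation of at least `2 * δ - 1 / N ≥ δ` on `A` or
`B`. -/
theorem altLaw_tail_le {N : ℕ} [NeZero N] (hN : 2 ≤ N) {P : Fin N → ℝ}
    (hP : P ∈ stdSimplex ℝ (Fin N)) {w₀ : Fin N} {c e β δ : ℝ} (hc : P w₀ ≤ c) (he : 0 ≤ e)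
    (hPe : ∀ w ≠ w₀, P w ≤ e) (hβ0 : 0 ≤ β) (hβ : β ≤ 1) (hδ : 0 < δ) (hNδ : 1 / N ≤ δ) :
    altLaw P {y | c * (1 - β) + 2 * δ < y}
      ≤ ENNReal.ofReal (2 * β + 2 / N + 2 * (e / δ ^ 2)) := by
  set t := c * (1 - β) + 2 * δ with ht
  have hc0 : 0 ≤ c := (hP.1 w₀).trans hc
  have ht0 : 0 ≤ t := by have := mul_nonneg hc0 (sub_nonneg.2 hβ); linarith
  have hm : MeasurableSet {y : ℝ | t < y} := measurableSet_Ioi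
  have hm' := measurable_pivot_decoder P hm
  rw [altLaw, Measure.map_apply (measurable_pivot_decoder P) hm, seedLaw,
    Measure.prod_apply_symm hm']
  refine lintegral_le_const (μ := volume.restrict (Set.Icc (0 : ℝ) 1)) ?_
  refine (ae_restrict_iff' measurableSet_Icc).2 (ae_of_all _ fun u hu => ?_)
  set Q := removeToken P w₀ with hQdef
  have hQ : ∀ w, 0 ≤ Q w := fun w => by
    rw [hQdef, removeToken]; split_ifs; exacts [le_rfl, hP.1 w]
  set A := Finset.univ.filter fun i : Fin N => eta i < u - t with hA
  set B := Finset.univ.filter fun i : Fin N => eta i ≤ u + t with hB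
  have hsub : (fun π : Equiv.Perm (Fin N) => (π, u)) ⁻¹'
      ((fun ξ : Equiv.Perm (Fin N) × ℝ => pivot (decoder P ξ) ξ) ⁻¹' {y | t < y})
      ⊆ {π | eta (π w₀) < β ∨ 1 - β < eta (π w₀)}
        ∪ ({π | δ ≤ |∑ w, Q w * ((if π w ∈ A then 1 else 0) - (A.card : ℝ) / N)|}
          ∪ {π | δ ≤ |∑ w, Q w * ((if π w ∈ B then 1 else 0) - (B.card : ℝ) / N)|}) := by
    intro π hπ
    by_cases hV : eta (π w₀) < β ∨ 1 - β < eta (π w₀)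
    · exact Or.inl hV
    rw [not_or, not_lt, not_lt] at hV
    simp only [Set.mem_preimage, Set.mem_ofPred_eq, pivot, decoder, Equiv.apply_symm_apply] at hπ
    refine Or.inr ((lt_abs.1 hπ).imp (fun h => ?_) fun h => ?_)
    · have := deviation_of_quantile_lt hN hP hc hβ hu.2 hV.1
        (show eta (quantile P π u) < u - t by linarith)
      exact le_trans (by linarith) (this.trans (le_abs_self _))
    · have := deviation_of_lt_quantile hN hP hc hβ ht0 hu.1 hV.2
        (show u + t < eta (quantile P π u) by linarith)
      exact le_trans (by linarith) (this.trans (neg_le_abs _))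
  have hdiv : (∑ w, Q w ^ 2) / δ ^ 2 ≤ e / δ ^ 2 :=
    div_le_div_of_nonneg_right (sum_removeToken_sq_le hP he hPe) (sq_nonneg δ)
  have hdev := fun A : Finset (Fin N) =>
    (uniformPerm_deviation_le hQ A hδ).trans (ENNReal.ofReal_le_ofReal hdiv)
  refine (measure_mono hsub).trans ((measure_union_le _ _).trans ((add_le_add
    (uniformPerm_extreme_rank_le hN w₀ hβ0)
    ((measure_union_le _ _).trans (add_le_add (hdev A) (hdev B)))).trans_eq ?_))
  rw [← ENNReal.ofReal_add (by positivity) (by positivity),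
    ← ENNReal.ofReal_add (by positivity) (by positivity)]
  congr 1
  ring

/-- Under the alternative, the pivotal statistic rarely comes close to `c = 1 - Δ`, uniformly over
the belief class. -/
theorem exists_altLaw_tail_le {Δ : ℝ} (hΔ1 : Δ < 1) {ε : ℕ → ℝ} (hε : Tendsto ε atTop (𝓝 0))
    {ρ : ℝ} (hρ : 0 < ρ) :
    ∃ t < 1 - Δ, ∀ᶠ n : ℕ in atTop, ∀ P ∈ beliefClass (n + 1) Δ (ε (n + 1)),
      altLaw P {y | t < y} ≤ ENNReal.ofReal ρ := by
  set c := 1 - Δ with hcdef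
  have hc : 0 < c := by linarith
  -- Each of the three error terms `2β`, `2/N`, `2ε/δ²` gets a share `ρ / 3`.
  set β := min 1 (ρ / 6) with hβ
  have hβ0 : 0 < β := lt_min one_pos (by positivity)
  have hβρ : β ≤ ρ / 6 := min_le_right _ _
  -- The threshold becomes `c - c * β / 2 < c`.
  set δ := c * β / 4 with hδ
  have hδ0 : 0 < δ := by positivity
  refine ⟨c * (1 - β) + 2 * δ, by nlinarith [mul_pos hc hβ0], ?_⟩
  have hε' : Tendsto (fun n : ℕ => ε (n + 1)) atTop (𝓝 0) := hε.comp (tendsto_add_atTop_nat 1)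
  have hinv : Tendsto (fun n : ℕ => 1 / ((n : ℝ) + 1)) atTop (𝓝 0) :=
    tendsto_one_div_add_atTop_nhds_zero_nat
  filter_upwards [hε'.eventually_lt_const (show 0 < ρ / 6 * δ ^ 2 by positivity),
    hinv.eventually_lt_const (show 0 < ρ / 6 by positivity), hinv.eventually_lt_const hδ0,
    eventually_ge_atTop 1] with n h1 h2 h3 hn P hP
  obtain ⟨hPs, hP0, hP1⟩ := hP
  have he : 0 ≤ ε (n + 1) := by
    refine le_trans ?_ hP1
    rw [nthLargest, dif_pos (by omega)]
    exact hPs.1 _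
  refine (altLaw_tail_le (by omega) hPs ((apply_topToken P).trans_le hP0) he
    (fun w hw => (le_nthLargest_one P hw).trans hP1) hβ0.le (min_le_left _ _) hδ0
    (by push_cast; exact h3.le)).trans (ENNReal.ofReal_le_ofReal ?_)
  have h4 : ε (n + 1) / δ ^ 2 ≤ ρ / 6 := by
    rw [div_le_iff₀ (by positivity)]; exact h1.le
  have h5 : (2 : ℝ) / ((n + 1 : ℕ) : ℝ) = 2 * (1 / ((n : ℝ) + 1)) := by push_cast; ring
  rw [h5]
  linarith

/-! ### The truncated score -/

theorem measurable_truncate_hdif (M Δ : ℝ) : Measurable (truncate M (hdif Δ)) := by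
  have hf : ∀ Δ, Measurable (fdif Δ) := fun Δ => by unfold fdif; fun_prop
  have hh : Measurable (hdif Δ) :=
    ENNReal.measurable_log.comp ((hf Δ).div (hf 0)).ennreal_ofReal
  exact measurable_ereal_toReal.comp (measurable_const.max (hh.min measurable_const))

theorem truncate_of_eq_bot {M : ℝ} {h : ℝ → EReal} {r : ℝ} (hr : h r = ⊥) :
    truncate M h r = -M := by
  simp [truncate, hr]

theorem truncate_of_eq_coe {M : ℝ} {h : ℝ → EReal} {r x : ℝ} (hr : h r = x) :
    truncate M h r = max (-M) (min x M) := by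
  have hmono : Monotone ((↑) : ℝ → EReal) := EReal.coe_strictMono.monotone
  rw [truncate, hr, ← hmono.map_min, ← hmono.map_max, EReal.toReal_coe]

/-- For `r ≥ 1` both densities vanish and the quotient is `0 / 0 = 0`, so the value is still `-M`.
-/
theorem truncate_hdif_of_le {M Δ r : ℝ} (hΔ : Δ < 1) (hr : 1 - Δ ≤ r) :
    truncate M (hdif Δ) r = -M := by
  apply truncate_of_eq_bot
  have h0 : fdif Δ r = 0 := by
    rw [fdif, max_eq_right, mul_zero]
    rw [sub_nonpos, one_le_div (by linarith)]
    exact hr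
  simp [hdif, h0]

theorem truncate_hdif_of_lt {M Δ r : ℝ} (hΔ0 : 0 < Δ) (hΔ : Δ < 1) (hr : r < 1 - Δ) :
    truncate M (hdif Δ) r
      = max (-M) (min (Real.log ((1 - Δ - r) / (1 - r) / (1 - Δ) ^ 2)) M) := by
  apply truncate_of_eq_coe
  have hc : 0 < 1 - Δ := by linarith
  have h1 : 0 < 1 - r := by linarith
  have h2 : 0 < 1 - Δ - r := by linarith
  have hratio : fdif Δ r / fdif 0 r = (1 - Δ - r) / (1 - r) / (1 - Δ) ^ 2 := by
    have h3 : 1 - r / (1 - Δ) = (1 - Δ - r) / (1 - Δ) := by field_simp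
    rw [fdif, fdif, sub_zero, div_one, div_one, h3, max_eq_left (by positivity),
      max_eq_left h1.le]
    field_simp
  rw [hdif, hratio, ENNReal.log_ofReal_of_pos (by positivity)]

theorem truncate_hdif_le {M Δ : ℝ} (hM : 0 ≤ M) (hΔ0 : 0 < Δ) (hΔ : Δ < 1) (r : ℝ) :
    truncate M (hdif Δ) r ≤ Real.log (1 / (1 - Δ) ^ 2) := by
  have hc : 0 < 1 - Δ := by linarith
  have hL : 0 ≤ Real.log (1 / (1 - Δ) ^ 2) := by
    refine Real.log_nonneg ?_
    rw [one_le_div (by positivity)]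
    nlinarith
  rcases le_or_gt (1 - Δ) r with hr | hr
  · rw [truncate_hdif_of_le hΔ hr]; linarith
  rw [truncate_hdif_of_lt hΔ0 hΔ hr]
  refine max_le (by linarith) ((min_le_left _ _).trans ?_)
  have h1 : 0 < 1 - r := by linarith
  have h2 : 0 < 1 - Δ - r := by linarith
  refine Real.log_le_log (by positivity) ?_
  gcongr
  rw [div_le_one h1]
  linarith

theorem neg_le_truncate (M : ℝ) (hM : 0 ≤ M) (h : ℝ → EReal) (r : ℝ) : -M ≤ truncate M h r := by
  induction hr : h r with
  | bot => rw [truncate_of_eq_bot hr]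
  | coe x => rw [truncate_of_eq_coe hr]; exact le_max_left _ _
  | top =>
    have : (max ((-M : ℝ) : EReal) (min ⊤ (M : EReal))) = ((M : ℝ) : EReal) := by
      rw [min_eq_right le_top, max_eq_right (EReal.coe_le_coe_iff.2 (by linarith))]
    rw [truncate, hr, this, EReal.toReal_coe]
    linarith

/-- Away from `1 - Δ`, the truncated score is bounded below independently of the truncation. -/
theorem exists_neg_le_truncate_hdif {Δ t : ℝ} (hΔ0 : 0 < Δ) (hΔ : Δ < 1) (ht : t < 1 - Δ) :
    ∃ C : ℝ, 0 ≤ C ∧ ∀ M, 0 ≤ M → ∀ r ≤ t, -C ≤ truncate M (hdif Δ) r := by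
  -- The likelihood ratio decreases in `r`, so it is smallest at `t`. The absolute value gives `-C ≤
  -- 0 ≤ M`, so the upper truncation does no harm.
  refine ⟨|Real.log ((1 - Δ - t) / (1 - t) / (1 - Δ) ^ 2)|, abs_nonneg _, fun M hM r hr => ?_⟩
  rw [truncate_hdif_of_lt hΔ0 hΔ (hr.trans_lt ht)]
  refine le_max_of_le_right (le_min ((neg_abs_le _).trans ?_)
    (le_trans (neg_nonpos.2 (abs_nonneg _)) hM))
  have hc : 0 < 1 - Δ := by linarith
  have h1 : 0 < 1 - r := by linarith
  have h2 : 0 < 1 - Δ - r := by linarith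
  have h3 : 0 < 1 - t := by linarith
  have h4 : 0 < 1 - Δ - t := by linarith
  refine Real.log_le_log (by positivity) ?_
  gcongr ?_ / _
  rw [div_le_div_iff₀ h3 h1]
  nlinarith

/-! ### The null law -/

/-- Under the null hypothesis, the pivotal statistic exceeds `1 - Δ` with probability bounded away
from zero. -/
theorem le_nullLaw_tail {n : ℕ} (hn : 1 ≤ n) {Δ : ℝ} (hΔ0 : 0 < Δ) (hΔ1 : Δ ≤ 1) :
    Δ ^ 2 / 8 ≤ (nullLaw (n + 1)).real (Set.Ici (1 - Δ)) := by
  classical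
  have hn' : (1 : ℝ) ≤ n := by exact_mod_cast hn
  set I : Set (Fin (n + 1)) := {i | eta i ≤ Δ / 2} with hI
  set J : Set ℝ := Set.Icc (1 - Δ / 2) 1 with hJ
  set μ := (PMF.uniformOfFintype (Fin (n + 1))).toMeasure with hμ
  -- A rank in the lowest `Δ / 2` and `U` in the highest `Δ / 2` force `U - eta ≥ 1 - Δ`.
  have hsub : I ×ˢ J ⊆ (fun p : Fin (n + 1) × ℝ => |p.2 - eta p.1|) ⁻¹' Set.Ici (1 - Δ) := by
    rintro ⟨i, u⟩ ⟨hi, hu⟩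
    have hi' : eta i ≤ Δ / 2 := hi
    have hu' : 1 - Δ / 2 ≤ u := hu.1
    exact le_trans (by linarith : 1 - Δ ≤ u - eta i) (le_abs_self _)
  have hJm : (volume.restrict (Set.Icc (0 : ℝ) 1)).real J = Δ / 2 := by
    rw [measureReal_restrict_apply measurableSet_Icc,
      Set.inter_eq_left.2 (Set.Icc_subset_Icc_left (by linarith)), Real.volume_real_Icc_of_le
      (by linarith)]
    ring
  have hIm : Δ / 4 ≤ μ.real I := by
    rw [measureReal_def, PMF.toMeasure_uniformOfFintype_apply _ MeasurableSet.of_discrete,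
      Fintype.card_fin, ENNReal.toReal_div, ENNReal.toReal_natCast, ENNReal.toReal_natCast,
      le_div_iff₀ (by positivity), ← Set.toFinset_card,
      ← Finset.card_image_of_injective _ Fin.val_injective]
    have hrange : Finset.range (⌊Δ / 2 * n⌋₊ + 1) ⊆ I.toFinset.image Fin.val := by
      intro m hm
      have hm' : (m : ℝ) ≤ Δ / 2 * n :=
        (Nat.le_floor_iff (by positivity)).1 (Nat.lt_succ_iff.1 (Finset.mem_range.1 hm))
      have hmn : (m : ℝ) < (n + 1 : ℕ) := by push_cast; nlinarith
      simp only [Finset.mem_image, Set.mem_toFinset]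
      refine ⟨⟨m, by exact_mod_cast hmn⟩, ?_, rfl⟩
      simp only [hI, Set.mem_ofPred_eq, eta]
      push_cast
      rw [add_sub_cancel_right, div_le_iff₀ (by linarith)]
      exact hm'
    have hcard : ((⌊Δ / 2 * n⌋₊ + 1 : ℕ) : ℝ) ≤ (I.toFinset.image Fin.val).card := by
      exact_mod_cast (Finset.card_range _).symm.trans_le (Finset.card_le_card hrange)
    refine le_trans ?_ hcard
    push_cast
    nlinarith [Nat.lt_floor_add_one (Δ / 2 * n)]
  rw [nullLaw, map_measureReal_apply measurable_rank measurableSet_Ici]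
  refine le_trans ?_ (measureReal_mono hsub)
  rw [measureReal_prod_prod, hJm]
  nlinarith

theorem integral_truncate_hdif_le {n : ℕ} (hn : 1 ≤ n) {M Δ : ℝ} (hM : 0 ≤ M) (hΔ0 : 0 < Δ)
    (hΔ1 : Δ < 1) :
    ∫ y, truncate M (hdif Δ) y ∂(nullLaw (n + 1))
      ≤ Real.log (1 / (1 - Δ) ^ 2) - M * (Δ ^ 2 / 8) := by
  set L := Real.log (1 / (1 - Δ) ^ 2) with hL
  have hub := fun r => truncate_hdif_le hM hΔ0 hΔ1 r
  have hLnn : 0 ≤ L := by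
    refine Real.log_nonneg ?_
    rw [one_le_div (by nlinarith)]
    nlinarith
  have hint : Integrable (truncate M (hdif Δ)) (nullLaw (n + 1)) :=
    Integrable.of_bound (measurable_truncate_hdif M Δ).aestronglyMeasurable (max M L)
      (ae_of_all _ fun y => abs_le.2
        ⟨(neg_le_neg (le_max_left _ _)).trans (neg_le_truncate M hM _ y),
          (hub y).trans (le_max_right _ _)⟩)
  have hone : Integrable ((Set.Ici (1 - Δ)).indicator (1 : ℝ → ℝ)) (nullLaw (n + 1)) :=
    (integrable_const (1 : ℝ)).indicator measurableSet_Ici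
  have hind : Integrable (fun y => L - M * (Set.Ici (1 - Δ)).indicator 1 y) (nullLaw (n + 1)) :=
    (integrable_const L).sub (hone.const_mul M)
  calc ∫ y, truncate M (hdif Δ) y ∂(nullLaw (n + 1))
      ≤ ∫ y, (L - M * (Set.Ici (1 - Δ)).indicator 1 y) ∂(nullLaw (n + 1)) := by
        -- On `[1 - Δ, ∞)` the comparison reads `-M ≤ L - M`, which needs `L ≥ 0`.
        refine integral_mono hint hind fun y => ?_
        by_cases hy : 1 - Δ ≤ y
        · simp only [truncate_hdif_of_le hΔ1 hy]
          simp [hy, hLnn]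
        · simpa only [Set.indicator_of_notMem (show y ∉ Set.Ici (1 - Δ) from hy), mul_zero,
            sub_zero] using hub y
    _ = L - M * (nullLaw (n + 1)).real (Set.Ici (1 - Δ)) := by
        rw [integral_sub (integrable_const L) (hone.const_mul M), integral_const_mul, integral_indicator_one measurableSet_Ici]
        simp
    _ ≤ L - M * (Δ ^ 2 / 8) := by
        have := mul_le_mul_of_nonneg_left (le_nullLaw_tail hn hΔ0 hΔ1.le) hM
        linarith

/-! ### The limit efficiency -/

/-- The rate is minus an infimum over `θ`, so one well-chosen `θ` suffices. -/
theorem le_efficiency {ι : Type*} {μ₀ : Measure ℝ} {μ₁ : ι → Measure ℝ} {C : Set ι} {h : ℝ → ℝ}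
    {θ x b : ℝ} (hθ : 0 ≤ θ) (hb : 0 < b)
    (hlaplace : ∀ P ∈ C,
      ∫⁻ y, ENNReal.ofReal (Real.exp (-θ * h y)) ∂(μ₁ P) ≤ ENNReal.ofReal b)
    (hx : θ * ∫ y, h y ∂μ₀ + Real.log b ≤ -x) : (x : EReal) ≤ efficiency μ₀ μ₁ C h := by
  rw [efficiency, EReal.le_neg]
  refine iInf₂_le_of_le θ hθ (iSup₂_le fun P hP => ?_)
  refine (add_le_add_right (ENNReal.log_le_log (hlaplace P hP)) _).trans ?_
  rw [ENNReal.log_ofReal_of_pos hb, ← EReal.coe_add, ← EReal.coe_neg]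
  exact EReal.coe_le_coe_iff.2 hx

theorem efficiency_empty {ι : Type*} (μ₀ : Measure ℝ) (μ₁ : ι → Measure ℝ) (h : ℝ → ℝ) :
    efficiency μ₀ μ₁ ∅ h = ⊤ := by
  rw [efficiency, EReal.neg_eq_top_iff, eq_bot_iff]
  exact iInf₂_le_of_le 0 le_rfl (by simp)

theorem beliefClass_one {N : ℕ} [NeZero N] (e : ℝ) : beliefClass N 1 e = ∅ := by
  refine Set.eq_empty_of_forall_notMem fun P ⟨hP, h0, _⟩ => ?_
  have hle : ∑ w, P w ≤ 0 := Finset.sum_nonpos fun w _ => by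
    linarith [le_nthLargest_zero P w]
  linarith [hP.2]

theorem lintegral_exp_le {μ : Measure ℝ} [IsProbabilityMeasure μ] {h : ℝ → ℝ} {θ C M t ρ : ℝ}
    (hθ : 0 ≤ θ) (hρ : 0 ≤ ρ) (hC : ∀ y ≤ t, -C ≤ h y) (hM : ∀ y, -M ≤ h y)
    (ht : μ {y | t < y} ≤ ENNReal.ofReal ρ) :
    ∫⁻ y, ENNReal.ofReal (Real.exp (-θ * h y)) ∂μ
      ≤ ENNReal.ofReal (Real.exp (θ * C) + Real.exp (θ * M) * ρ) := by
  calc ∫⁻ y, ENNReal.ofReal (Real.exp (-θ * h y)) ∂μ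
      ≤ ∫⁻ y, (ENNReal.ofReal (Real.exp (θ * C))
          + {y | t < y}.indicator (fun _ => ENNReal.ofReal (Real.exp (θ * M))) y) ∂μ := by
        refine lintegral_mono fun y => ?_
        by_cases hy : t < y
        · rw [Set.indicator_of_mem (show y ∈ {y | t < y} from hy)]
          refine le_add_left (ENNReal.ofReal_le_ofReal (Real.exp_le_exp.2 ?_))
          nlinarith [mul_le_mul_of_nonneg_left (hM y) hθ]
        · refine le_add_right (ENNReal.ofReal_le_ofReal (Real.exp_le_exp.2 ?_))
          nlinarith [mul_le_mul_of_nonneg_left (hC y (not_lt.1 hy)) hθ]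
    _ = ENNReal.ofReal (Real.exp (θ * C))
          + ENNReal.ofReal (Real.exp (θ * M)) * μ {y | t < y} := by
        rw [lintegral_add_left measurable_const, lintegral_const, measure_univ, mul_one,
          lintegral_indicator_const (show MeasurableSet {y | t < y} from measurableSet_Ioi)]
    _ ≤ ENNReal.ofReal (Real.exp (θ * C) + Real.exp (θ * M) * ρ) := by
        rw [ENNReal.ofReal_add (Real.exp_nonneg _) (by positivity),
          ENNReal.ofReal_mul (Real.exp_nonneg _)]
        gcongr

theorem eventually_le_limitEfficiency {Δ : ℝ} (hΔ0 : 0 < Δ) (hΔ1 : Δ < 1) {ε : ℕ → ℝ}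
    (hε : Tendsto ε atTop (𝓝 0)) (x : ℝ) :
    ∀ᶠ M : ℝ in atTop, (x : EReal) ≤ limitEfficiency ε Δ (truncate M (hdif Δ)) := by
  set L := Real.log (1 / (1 - Δ) ^ 2) with hL
  -- Solves `a * (Δ ^ 2 / 8) = |x| + 1 + log (e + 1)`: the `1` pays for `a * L / M`, the logarithm
  -- for the Laplace bound.
  set a := (|x| + 1 + Real.log (Real.exp 1 + 1)) / (Δ ^ 2 / 8) with ha
  have hlog : 0 ≤ Real.log (Real.exp 1 + 1) :=
    Real.log_nonneg (by linarith [Real.exp_nonneg 1])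
  have ha0 : 0 ≤ a := by positivity
  -- With `θ = a / M` the weight `exp (θ * M)` of the tail is `exp a` for every `M`, so `t` and `C`
  -- can be fixed before `M`.
  obtain ⟨t, ht, htail⟩ := exists_altLaw_tail_le hΔ1 hε (Real.exp_pos (-a))
  obtain ⟨C, hC0, hC⟩ := exists_neg_le_truncate_hdif hΔ0 hΔ1 ht
  filter_upwards [eventually_gt_atTop 0, eventually_ge_atTop (a * C),
    eventually_ge_atTop (a * L)] with M hM hMC hML
  refine le_liminf_of_le (by isBoundedDefault) ?_
  filter_upwards [htail, eventually_ge_atTop 1] with n hn hn1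
  have hθ : 0 ≤ a / M := div_nonneg ha0 hM.le
  refine le_efficiency (b := Real.exp 1 + 1) hθ (by positivity) (fun P hP => ?_) ?_
  · refine (lintegral_exp_le hθ (Real.exp_nonneg _) (hC M hM.le)
      (neg_le_truncate M hM.le _) (hn P hP)).trans (ENNReal.ofReal_le_ofReal ?_)
    rw [← Real.exp_add, div_mul_cancel₀ _ hM.ne', add_neg_cancel, Real.exp_zero]
    gcongr
    rw [div_mul_eq_mul_div, div_le_one hM]
    exact hMC
  · have h1 := mul_le_mul_of_nonneg_left (integral_truncate_hdif_le hn1 hM.le hΔ0 hΔ1) hθ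
    have h2 : a / M * (L - M * (Δ ^ 2 / 8)) = a * L / M - a * (Δ ^ 2 / 8) := by
      field_simp
    have h3 : a * (Δ ^ 2 / 8) = |x| + 1 + Real.log (Real.exp 1 + 1) :=
      div_mul_cancel₀ _ (by positivity)
    have h4 : a * L / M ≤ 1 := (div_le_one hM).2 hML
    linarith [le_abs_self x]

theorem tendsto_zero_of_log_mul {ε : ℕ → ℝ}
    (hε : Tendsto (fun N : ℕ => Real.log N * ε N) atTop (𝓝 0)) : Tendsto ε atTop (𝓝 0) := by
  have hlog : Tendsto (fun N : ℕ => (Real.log N)⁻¹) atTop (𝓝 0) :=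
    tendsto_inv_atTop_zero.comp (Real.tendsto_log_atTop.comp tendsto_natCast_atTop_atTop)
  have h := hlog.mul hε
  rw [mul_zero] at h
  refine h.congr' ?_
  filter_upwards [eventually_ge_atTop 2] with N hN
  have : 0 < Real.log N := Real.log_pos (by exact_mod_cast hN)
  field_simp

end InvWatermark

theorem theorem4p2 (Δ : ℝ) (hΔ0 : 0 < Δ) (hΔ1 : Δ ≤ 1) (ε : ℕ → ℝ)
    (hε : Tendsto (fun N : ℕ => Real.log N * ε N) atTop (𝓝 0)) :
    Tendsto
      (fun M : ℝ => InvWatermark.limitEfficiency ε Δ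
        (InvWatermark.truncate M (InvWatermark.hdif Δ)))
      atTop (𝓝 ⊤) := by
  rcases hΔ1.eq_or_lt with rfl | hΔ1
  · simp [InvWatermark.limitEfficiency, InvWatermark.beliefClass_one,
      InvWatermark.efficiency_empty]
  · refine EReal.tendsto_nhds_top_iff_real.2 fun x => ?_
    filter_upwards [InvWatermark.eventually_le_limitEfficiency hΔ0 hΔ1
      (InvWatermark.tendsto_zero_of_log_mul hε) (x + 1)] with M hM
    exact lt_of_lt_of_le (EReal.coe_lt_coe_iff.2 (lt_add_one x)) hM
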